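/- Let $\Omega\subset\mathbb R^N$ be open, let $f_1,\dots,f_M:\Omega\to\mathbb R$ be of class $C^3$ with gradients $\nabla f_1(\mathbf x),\dots,\nabla f_M(\mathbf x)$ linearly independent at every $\mathbf x\in\Omega$, and let $v_1,\dots,v_M\in\mathbb R$ be reference values. For $\mathbf x\in\Omega$ let $\mathbf g_m(\mathbf x)$ be the orthogonal projection of $\nabla f_m(\mathbf x)$ onto the orthogonal complement of $\operatorname{span}\{\nabla f_1(\mathbf x),\dots,\nabla f_{m-1}(\mathbf x)\}$ (the tangent space of the reference manifold of $f_1,\dots,f_{m-1}$). The narrow path algorithm started at $\mathbf x\in\Omega$ sets $\hat{\mathbf x}_0=\mathbf x$ and, for $m=1,\dots,M-1$, follows the solution of $\mathbf y'=\mathbf g_m(\mathbf y)$, $\mathbf y(0)=\hat{\mathbf x}_{m-1}$, inside $\Omega$ (forwards or backwards in time) until $f_m(\mathbf y)=v_m$; the point reached is $\hat{\mathbf x}_m=\hat{\mathbf x}_m(\mathbf x)$. Let $\Omega^*\subset\Omega$ be the set of points from which all $M-1$ steps can be carried out, and on $\Omega^*$ put $\hat f_j(\mathbf x)=f_j(\hat{\mathbf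 x}_{j-1}(\mathbf x))$, $j=1,\dots,M$ (so $\hat f_1=f_1$). A finite family of functions satisfies the Frobenius condition on a set if at each point of the set the commutator $XY-YX$ of the gradient fields $X,Y$ of any two of its members lies in the span of the gradients of its members. Two functions are decoupled on a set if at each point of the set both are differentiable and their gradients are orthogonal. Let $k\le M$. Suppose that $\mathcal S_k=\{f_1,\dots,f_k\}$ satisfies the Frobenius condition on $\Omega$, and that $\hat{\mathcal S}_h=\{\hat f_1,\dots,\hat f_h\}$ satisfies the Frobenius condition on $\Omega^*$ for every $h\le k$. Then for all $i\le k$ and $j\le M$ with $i\ne j$, the features $\hat f_i$ and $\hat f_j$ are decoupled on all of $\Omega^*$. In particular, the Frobenius condition being vacuous for a single feature, $\hat f_1$ and $\hat f_j$ are decoupled on $\Omega^*$ for $j=2,\dots,M$ without any Frobenius hypothesis. -/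

import Mathlib

/-- The signal space `ℝ^N` with its Euclidean structure. -/
abbrev Signal (N : ℕ) : Type := EuclideanSpace ℝ (Fin N)

/-- Two features are decoupled on `U`: at every point of `U` both are differentiable and their
gradients are orthogonal. -/
def DecoupledOn {N : ℕ} (p q : Signal N → ℝ) (U : Set (Signal N)) : Prop :=
  ∀ x ∈ U, DifferentiableAt ℝ p x ∧ DifferentiableAt ℝ q x ∧
    inner ℝ (gradient p x) (gradient q x) = 0

/-- The Frobenius condition on `U` for the gradients of the features `F j`, `j ∈ I`: the commutator
`XY - YX` of the gradient fields of any two of them lies pointwise in the span of the gradients. -/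
def FrobeniusOn {N M : ℕ} (F : Fin M → Signal N → ℝ) (I : Set (Fin M)) (U : Set (Signal N)) :
    Prop :=
  ∀ x ∈ U, ∀ a ∈ I, ∀ b ∈ I,
    VectorField.lieBracket ℝ (gradient (F a)) (gradient (F b)) x ∈
      Submodule.span ℝ ((fun c => gradient (F c) x) '' I)

/-- The tangent space at `x` of the reference manifold of the features with index `< m`, i.e. the
orthogonal complement of the span of their gradients. -/
noncomputable def refTangent {N M : ℕ} (f : Fin M → Signal N → ℝ) (m : Fin M) (x : Signal N) :
    Submodule ℝ (Signal N) :=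
  (Submodule.span ℝ ((fun c => gradient (f c) x) '' {c | c < m}))ᗮ

/-- The orthogonal projection of the gradient of `f m` on the tangent space of the reference
manifold of the preceding features. -/
noncomputable def projGradient {N M : ℕ} (f : Fin M → Signal N → ℝ) (m : Fin M) (x : Signal N) :
    Signal N :=
  (refTangent f m x).starProjection (gradient (f m) x)

/-- Starting at `y` and following the field `projGradient f m` inside `Ω` until `f m` takes its
reference value `v m` ends at `z`. The time `T` may have either sign: the curve is followed upwards
or downwards, according to the sign of `v m - f m y`. -/
def FollowsUntil {N M : ℕ} (Ω : Set (Signal N)) (f : Fin M → Signal N → ℝ) (v : Fin M → ℝ)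
    (m : Fin M) (y z : Signal N) : Prop :=
  ∃ (γ : ℝ → Signal N) (T : ℝ), γ 0 = y ∧ γ T = z ∧ f m z = v m ∧
    ∀ t ∈ Set.uIcc 0 T, γ t ∈ Ω ∧
      HasDerivWithinAt γ (projGradient f m (γ t)) (Set.uIcc 0 T) t

/-- The narrow path algorithm, started at `x`, completes its first `m` steps and is then at the
given point; the step with number `m + 1` adjusts the feature with (zero-based) index `m`. -/
def NarrowPath {N M : ℕ} (Ω : Set (Signal N)) (f : Fin M → Signal N → ℝ) (v : Fin M → ℝ) :
    ℕ → Signal N → Signal N → Prop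
  | 0, x, y => x ∈ Ω ∧ y = x
  | m + 1, x, z => ∃ hm : m < M, ∃ y, NarrowPath Ω f v m x y ∧ FollowsUntil Ω f v ⟨m, hm⟩ y z

open Classical in
/-- The normalization map computed by the first `m` steps of the narrow path algorithm (with the
irrelevant value `x` at those `x` from which the steps cannot be carried out). -/
noncomputable def narrowMap {N M : ℕ} (Ω : Set (Signal N)) (f : Fin M → Signal N → ℝ)
    (v : Fin M → ℝ) (m : ℕ) (x : Signal N) : Signal N :=
  if h : ∃ y, NarrowPath Ω f v m x y then h.choose else x

/-- The output features of the narrow path algorithm: with zero-based indices, the feature `j` is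
evaluated after the `j` features before it have been normalized. -/
noncomputable def hatFeature {N M : ℕ} (Ω : Set (Signal N)) (f : Fin M → Signal N → ℝ)
    (v : Fin M → ℝ) (j : Fin M) (x : Signal N) : ℝ :=
  f j (narrowMap Ω f v j x)

/-- The points of `Ω` from which the narrow path algorithm runs to completion, so that all the
output features are defined there. -/
def narrowDomain {N M : ℕ} (Ω : Set (Signal N)) (f : Fin M → Signal N → ℝ) (v : Fin M → ℝ) :
    Set (Signal N) :=
  {x | x ∈ Ω ∧ ∀ j : Fin M, ∃ y, NarrowPath Ω f v j x y}

/-!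
The narrow path from `x` adjusts the features one at a time, and the step adjusting `f a` follows
the projected gradient of `f a`, along which the earlier features are constant. Paths that have met
stay together, so every later `hatFeature` is constant along the curve of such a step; hence its
gradient is orthogonal to the projected gradients of the earlier features on the respective
reference manifolds. On the reference manifold of the features before `f a`, moreover,
`hatFeature a` agrees with `f a`, and Lagrange multipliers show that its gradient there is the
projected gradient of `f a`. So the gradients of `hatFeature i` and `hatFeature j`, `i < j`, are
orthogonal on the reference manifold of the features before `f i`.

The orthogonality is carried from there to all of `narrowDomain` by going back through the steps of
the algorithm. Let `φ = hatFeature a` with `a < i`, and let `χ`, `ψ` be `hatFeature i` and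
`hatFeature j`. The curve of the step adjusting `f a` is an integral curve of `∇ φ`. By induction
on `i`, the gradient of `φ` is orthogonal to those of `χ` and `ψ`, so that by the symmetry of the
second derivatives `[∇ φ, ∇ χ] = -2 (Hess φ) ∇ χ`, and `⟪[∇ φ, ∇ χ], ∇ ψ⟫` is the derivative of
`⟪∇ χ, ∇ ψ⟫` along the curve. By the Frobenius condition only the component of the bracket along
`∇ χ` contributes, so this derivative is at most a constant times `|⟪∇ χ, ∇ ψ⟫|`, and Gronwall's
inequality shows that a zero of `⟪∇ χ, ∇ ψ⟫` at one point of the curve propagates to all of it.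

The gradients exist because the flow of a `C^n` field is `C^n` in time and initial value. A curve
of the flow, rescaled to `[0, 1]`, is a zero of the residual of an integral equation on
`C([0, 1], E)`; the partial derivative of the residual in the curve is the identity minus a Volterra
operator, hence invertible, and the implicit function theorem applies.
-/

open Set Filter Topology Metric
open scoped ContDiff Gradient

section Superposition

universe u

variable {K : Type*} [TopologicalSpace K]

/-- The superposition (Nemytskii) operator `c ↦ G ∘ c` on continuous maps, with value `0` at those
`c` for which `G ∘ c` is not continuous. -/
noncomputable def superposition (K : Type*) [TopologicalSpace K] {E F : Type*} [TopologicalSpace E]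
    [TopologicalSpace F] [Zero F] (G : E → F) (c : C(K, E)) : C(K, F) :=
  ContinuousMap.mkD (G ∘ c) 0

theorem superposition_apply {E F : Type*} [TopologicalSpace E] [TopologicalSpace F] [Zero F]
    {Ω : Set E} {G : E → F} (hG : ContinuousOn G Ω) {c : C(K, E)} (hc : MapsTo c univ Ω) (t : K) :
    superposition K G c t = G (c t) :=
  ContinuousMap.mkD_apply_of_continuous
    (hG.comp_continuous c.continuous fun t => hc (mem_univ t))

variable [CompactSpace K]

/-- The evaluation `(A, h) ↦ (t ↦ A t (h t))` of a continuous family of operators at a continuous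
family of vectors, as a bounded bilinear map. -/
noncomputable def pointwiseApply (K : Type*) [TopologicalSpace K] [CompactSpace K] (E F : Type*)
    [NormedAddCommGroup E] [NormedSpace ℝ E] [NormedAddCommGroup F] [NormedSpace ℝ F] :
    C(K, E →L[ℝ] F) →L[ℝ] C(K, E) →L[ℝ] C(K, F) :=
  LinearMap.mkContinuous₂
    (LinearMap.mk₂ ℝ
      (fun (A : C(K, E →L[ℝ] F)) (h : C(K, E)) => (⟨fun t => A t (h t), by fun_prop⟩ : C(K, F)))
      (fun _ _ _ => rfl) (fun _ _ _ => rfl)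
      (fun _ _ _ => by ext; simp) (fun _ _ _ => by ext; simp)) 1
    fun A h => (ContinuousMap.norm_le _ (by positivity)).2 fun t =>
      calc ‖A t (h t)‖ ≤ ‖A t‖ * ‖h t‖ := (A t).le_opNorm _
        _ ≤ 1 * ‖A‖ * ‖h‖ := by
          rw [one_mul]
          gcongr
          exacts [A.norm_coe_le_norm t, h.norm_coe_le_norm t]

@[simp]
theorem pointwiseApply_apply {E F : Type*} [NormedAddCommGroup E] [NormedSpace ℝ E]
    [NormedAddCommGroup F] [NormedSpace ℝ F] (A : C(K, E →L[ℝ] F)) (h : C(K, E)) (t : K) :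
    pointwiseApply K E F A h t = A t (h t) := rfl

theorem exists_forall_dist_lt_of_continuousOn {E F : Type*} [NormedAddCommGroup E]
    [PseudoMetricSpace F] {Ω : Set E} (hΩ : IsOpen Ω) {G : E → F} (hG : ContinuousOn G Ω)
    {c : C(K, E)} (hc : MapsTo c univ Ω) {ε : ℝ} (hε : 0 < ε) :
    ∃ δ > 0, ∀ t, ∀ w ∈ ball (c t) δ, w ∈ Ω ∧ dist (G w) (G (c t)) < ε := by
  have hnhds (t : K) : ∀ᶠ p : E × K in 𝓝 (0, t),
      c p.2 + p.1 ∈ Ω ∧ dist (G (c p.2 + p.1)) (G (c p.2)) < ε := by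
    have ht : c t + 0 ∈ Ω := by simpa using hc (mem_univ t)
    have hGt := hG.continuousAt (hΩ.mem_nhds ht)
    have hadd : ContinuousAt (fun p : E × K => c p.2 + p.1) (0, t) := by fun_prop
    have hG' : ContinuousAt (fun p : E × K => G (c p.2)) (0, t) :=
      ContinuousAt.comp (by simpa using hGt) (by fun_prop)
    refine (hadd.eventually_mem (hΩ.mem_nhds ht)).and
      ((Tendsto.dist (ContinuousAt.comp (x := ((0, t) : E × K)) hGt hadd) hG').eventually_lt_const
        (by simpa using hε))
  have hunif : ∀ᶠ w in 𝓝 (0 : E), ∀ t ∈ (univ : Set K),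
      c t + w ∈ Ω ∧ dist (G (c t + w)) (G (c t)) < ε :=
    isCompact_univ.eventually_forall_of_forall_eventually fun t _ => hnhds t
  obtain ⟨δ, hδ, h⟩ := Metric.eventually_nhds_iff.1 hunif
  refine ⟨δ, hδ, fun t w hw => ?_⟩
  simpa using h (y := w - c t) (by simpa [dist_eq_norm] using hw) t (mem_univ t)

theorem continuousOn_superposition {E F : Type*} [NormedAddCommGroup E] [NormedAddCommGroup F]
    {Ω : Set E} (hΩ : IsOpen Ω) {G : E → F} (hG : ContinuousOn G Ω) :
    ContinuousOn (superposition K G) {c | MapsTo c univ Ω} := by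
  intro c hc
  refine ContinuousAt.continuousWithinAt (Metric.continuousAt_iff.2 fun ε hε => ?_)
  obtain ⟨δ, hδ, h⟩ := exists_forall_dist_lt_of_continuousOn hΩ hG hc hε
  refine ⟨δ, hδ, fun d hd => (ContinuousMap.dist_lt_iff hε).2 fun t => ?_⟩
  have hball (t : K) : d t ∈ ball (c t) δ := (ContinuousMap.dist_apply_le_dist t).trans_lt hd
  rw [superposition_apply hG fun t _ => (h t _ (hball t)).1, superposition_apply hG hc]
  exact (h t _ (hball t)).2

variable {E F : Type u} [NormedAddCommGroup E] [NormedSpace ℝ E]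
  [NormedAddCommGroup F] [NormedSpace ℝ F] {Ω : Set E}

theorem hasFDerivAt_superposition (hΩ : IsOpen Ω) {G : E → F} (hG : ContDiffOn ℝ 1 G Ω)
    {c : C(K, E)} (hc : MapsTo c univ Ω) :
    HasFDerivAt (superposition K G) (pointwiseApply K E F (superposition K (fderiv ℝ G) c)) c := by
  have hG' := hG.continuousOn_fderiv_of_isOpen hΩ le_rfl
  refine .of_isLittleO (Asymptotics.isLittleO_iff.2 fun ε hε => ?_)
  obtain ⟨δ, hδ, h⟩ := exists_forall_dist_lt_of_continuousOn hΩ hG' hc hε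
  filter_upwards [ball_mem_nhds c hδ] with d hd
  refine (ContinuousMap.norm_le _ (by positivity)).2 fun t => ?_
  have hball (t : K) : d t ∈ ball (c t) δ := (ContinuousMap.dist_apply_le_dist t).trans_lt hd
  rw [ContinuousMap.sub_apply, ContinuousMap.sub_apply, pointwiseApply_apply,
    superposition_apply hG.continuousOn fun t _ => (h t _ (hball t)).1,
    superposition_apply hG.continuousOn hc, superposition_apply hG' hc]
  calc ‖G (d t) - G (c t) - fderiv ℝ G (c t) (d t - c t)‖ ≤ ε * ‖d t - c t‖ :=
        (convex_ball (c t) δ).norm_image_sub_le_of_norm_fderiv_le'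
          (fun w hw => (hG.differentiableOn one_ne_zero).differentiableAt
            (hΩ.mem_nhds (h t w hw).1))
          (fun w hw => by simpa [dist_eq_norm] using (h t w hw).2.le)
          (mem_ball_self hδ) (hball t)
    _ ≤ ε * ‖d - c‖ := by gcongr; exact (d - c).norm_coe_le_norm t

theorem contDiffOn_superposition (hΩ : IsOpen Ω) {n : ℕ} {G : E → F} (hG : ContDiffOn ℝ n G Ω) :
    ContDiffOn ℝ n (superposition K G) {c | MapsTo c univ Ω} := by
  induction n generalizing F with
  | zero => exact contDiffOn_zero.2 (continuousOn_superposition hΩ hG.continuousOn)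
  | succ n ih =>
    have hfderiv := ih ((contDiffOn_succ_iff_fderiv_of_isOpen hΩ).1 hG).2.2
    have hU : IsOpen {c : C(K, E) | MapsTo c univ Ω} :=
      ContinuousMap.isOpen_setOfPred_mapsTo isCompact_univ hΩ
    refine (contDiffOn_succ_iff_hasFDerivWithinAt_of_uniqueDiffOn hU.uniqueDiffOn).2
      ⟨by simp, _, (pointwiseApply K E F).contDiff.comp_contDiffOn hfderiv, fun c hc => ?_⟩
    exact (hasFDerivAt_superposition hΩ (hG.of_le (by simp)) hc).hasFDerivWithinAt

end Superposition

section Integration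

open unitInterval Interval

variable {E : Type*} [NormedAddCommGroup E] [NormedSpace ℝ E]

/-- The Volterra integration operator `c ↦ (t ↦ ∫₀ᵗ c)` on `C([0, 1], E)`. -/
noncomputable def primitive (E : Type*) [NormedAddCommGroup E] [NormedSpace ℝ E] :
    C(I, E) →L[ℝ] C(I, E) :=
  LinearMap.mkContinuous
    { toFun c := ⟨fun t => ∫ r in (0 : ℝ)..t, c.IccExtend zero_le_one r,
        (intervalIntegral.continuous_primitive
          (fun _ _ => (c.IccExtend zero_le_one).continuous.intervalIntegrable _ _) 0).comp
            continuous_subtype_val⟩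
      map_add' c d := by
        ext t
        exact intervalIntegral.integral_add
          ((c.IccExtend zero_le_one).continuous.intervalIntegrable _ _)
          ((d.IccExtend zero_le_one).continuous.intervalIntegrable _ _)
      map_smul' a c := by
        ext t
        exact intervalIntegral.integral_smul a _ } 1
    fun c => (ContinuousMap.norm_le _ (by positivity)).2 fun t => by
      calc ‖∫ r in (0 : ℝ)..t, c.IccExtend zero_le_one r‖ ≤ ‖c‖ * |(t : ℝ) - 0| :=
            intervalIntegral.norm_integral_le_of_norm_le_const fun r _ =>
              c.norm_coe_le_norm (projIcc 0 1 zero_le_one r)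
        _ ≤ 1 * ‖c‖ := by
          rw [sub_zero, abs_of_nonneg t.2.1, mul_comm]
          gcongr
          exact t.2.2

theorem primitive_apply (c : C(I, E)) (t : I) :
    primitive E c t = ∫ r in (0 : ℝ)..t, c.IccExtend zero_le_one r := rfl

theorem hasDerivWithinAt_primitive [CompleteSpace E] (c : C(I, E)) (t : I) :
    HasDerivWithinAt (fun r => ∫ s in (0 : ℝ)..r, c.IccExtend zero_le_one s) (c t) I t := by
  have hcont := (c.IccExtend zero_le_one).continuous
  simpa using (intervalIntegral.integral_hasStrictDerivAt_right (hcont.intervalIntegrable 0 t)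
    (hcont.stronglyMeasurableAtFilter _ _) hcont.continuousAt).hasDerivAt.hasDerivWithinAt (s := I)

theorem norm_volterra_pow_apply_le (A : C(I, E →L[ℝ] E)) (n : ℕ) (h : C(I, E)) (t : I) :
    ‖((primitive E ∘L pointwiseApply I E E A) ^ n) h t‖ ≤ (‖A‖ * t) ^ n / n.factorial * ‖h‖ := by
  induction n generalizing t with
  | zero => simpa using h.norm_coe_le_norm t
  | succ n ih =>
    set d : C(I, E) := ((primitive E ∘L pointwiseApply I E E A) ^ n) h
    have hbound (r : ℝ) (hr : r ∈ Ι 0 (t : ℝ)) :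
        ‖(pointwiseApply I E E A d).IccExtend zero_le_one r‖ ≤
          ‖A‖ ^ (n + 1) / n.factorial * ‖h‖ * r ^ n := by
      rw [uIoc_of_le t.2.1] at hr
      have hrI : r ∈ I := ⟨hr.1.le, hr.2.trans t.2.2⟩
      rw [ContinuousMap.coe_IccExtend, IccExtend_of_mem _ _ hrI, pointwiseApply_apply]
      calc ‖A ⟨r, hrI⟩ (d ⟨r, hrI⟩)‖ ≤ ‖A‖ * ((‖A‖ * r) ^ n / n.factorial * ‖h‖) :=
            (A _).le_of_opNorm_le_of_le (A.norm_coe_le_norm _) (ih _)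
        _ = _ := by ring
    rw [pow_succ', mul_apply_eq_comp, ContinuousLinearMap.comp_apply, primitive_apply]
    calc _ ≤ |∫ r in (0 : ℝ)..t, ‖A‖ ^ (n + 1) / n.factorial * ‖h‖ * r ^ n| :=
          intervalIntegral.norm_integral_le_abs_of_norm_le
            ((MeasureTheory.ae_restrict_iff' measurableSet_uIoc).2 (.of_forall hbound))
            (by apply Continuous.intervalIntegrable; fun_prop)
      _ = (‖A‖ * t) ^ (n + 1) / (n + 1).factorial * ‖h‖ := by
          rw [intervalIntegral.integral_const_mul, integral_pow, Nat.factorial_succ,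
            zero_pow n.succ_ne_zero, sub_zero, abs_of_nonneg (by have := t.2.1; positivity)]
          push_cast
          field_simp
          ring

theorem isUnit_one_sub_volterra [CompleteSpace E] (A : C(I, E →L[ℝ] E)) :
    IsUnit (1 - primitive E ∘L pointwiseApply I E E A) := by
  set V := primitive E ∘L pointwiseApply I E E A
  obtain ⟨n, hn⟩ : ∃ n : ℕ, ‖A‖ ^ n / n.factorial < 1 :=
    ((FloorSemiring.tendsto_pow_div_factorial_atTop ‖A‖).eventually_lt_const one_pos).exists
  have hV : ‖V ^ n‖ ≤ ‖A‖ ^ n / n.factorial := by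
    refine ContinuousLinearMap.opNorm_le_bound _ (by positivity) fun h =>
      (ContinuousMap.norm_le _ (by positivity)).2 fun t => ?_
    refine (norm_volterra_pow_apply_le A n h t).trans ?_
    have := t.2.1
    gcongr
    exact mul_le_of_le_one_right (norm_nonneg A) t.2.2
  have hunit : IsUnit ((1 - V) * ∑ i ∈ Finset.range n, V ^ i) := by
    rw [mul_neg_geom_sum]
    exact isUnit_one_sub_of_norm_lt_one (R := C(I, E) →L[ℝ] C(I, E)) (hV.trans_lt hn)
  have hcomm : Commute (1 - V) (∑ i ∈ Finset.range n, V ^ i) :=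
    .sum_right _ _ _ fun i _ => ((Commute.one_left V).sub_left (.refl V)).pow_right i
  exact (hcomm.isUnit_mul_iff.1 hunit).1

end Integration

theorem uniqueDiffWithinAt_uIcc {a b t : ℝ} (hab : a ≠ b) (ht : t ∈ uIcc a b) :
    UniqueDiffWithinAt ℝ (uIcc a b) t :=
  uniqueDiffOn_Icc (by simpa using hab.symm) t ht

section Flow

open unitInterval

variable {E : Type*} [NormedAddCommGroup E] [NormedSpace ℝ E] {Ω : Set E} {g : E → E}

/-- The flow of the vector field `g` takes `y` to `z` in time `T`, which may have either sign,
along a curve that stays in `Ω`. -/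
def FlowsTo (Ω : Set E) (g : E → E) (T : ℝ) (y z : E) : Prop :=
  ∃ γ : ℝ → E, γ 0 = y ∧ γ T = z ∧ MapsTo γ (uIcc 0 T) Ω ∧
    IsIntegralCurveOn γ (fun _ => g) (uIcc 0 T)

theorem flowsTo_of_isIntegralCurveOn {γ : ℝ → E} {J : Set ℝ} (hJ : J.OrdConnected)
    (hγΩ : MapsTo γ J Ω) (hγ : IsIntegralCurveOn γ (fun _ => g) J) {s t : ℝ} (hs : s ∈ J)
    (ht : t ∈ J) : FlowsTo Ω g (t - s) (γ s) (γ t) := by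
  have hsub (r : ℝ) (hr : r ∈ uIcc 0 (t - s)) : r + s ∈ J := by
    refine hJ.uIcc_subset hs ht ?_
    rw [mem_uIcc] at hr ⊢
    grind
  refine ⟨fun r => γ (r + s), by simp, by simp, fun r hr => hγΩ (hsub r hr), fun r hr => ?_⟩
  simpa [Function.comp_def] using (hγ (r + s) (hsub r hr)).scomp r
    ((hasDerivAt_id r).add_const s).hasDerivWithinAt hsub

namespace FlowsTo

theorem left_mem {T : ℝ} {y z : E} (h : FlowsTo Ω g T y z) : y ∈ Ω := by
  obtain ⟨γ, rfl, -, hγΩ, -⟩ := h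
  exact hγΩ left_mem_uIcc

theorem symm {T : ℝ} {y z : E} (h : FlowsTo Ω g T y z) : FlowsTo Ω g (-T) z y := by
  obtain ⟨γ, rfl, rfl, hγΩ, hγ⟩ := h
  simpa using flowsTo_of_isIntegralCurveOn ordConnected_uIcc hγΩ hγ right_mem_uIcc left_mem_uIcc

theorem right_mem {T : ℝ} {y z : E} (h : FlowsTo Ω g T y z) : z ∈ Ω := h.symm.left_mem

theorem refl {y : E} (hy : y ∈ Ω) : FlowsTo Ω g 0 y y := by
  simpa using flowsTo_of_isIntegralCurveOn (J := {0}) (γ := fun _ => y) (g := g)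
    ordConnected_singleton (fun _ _ => hy)
    (fun t _ => HasFDerivWithinAt.of_subsingleton subsingleton_singleton) rfl rfl

theorem exists_of_mem_uIcc {T s : ℝ} {y z : E} (h : FlowsTo Ω g T y z) (hs : s ∈ uIcc 0 T) :
    ∃ x, FlowsTo Ω g s y x ∧ FlowsTo Ω g (T - s) x z := by
  obtain ⟨γ, rfl, rfl, hγΩ, hγ⟩ := h
  exact ⟨γ s, by simpa using flowsTo_of_isIntegralCurveOn ordConnected_uIcc hγΩ hγ left_mem_uIcc hs,
    flowsTo_of_isIntegralCurveOn ordConnected_uIcc hγΩ hγ hs right_mem_uIcc⟩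

theorem rescale {T : ℝ} {y z : E} (a : ℝ) (h : FlowsTo Ω g (T * a) y z) :
    FlowsTo Ω (a • g) T y z := by
  obtain ⟨γ, rfl, rfl, hγΩ, hγ⟩ := h
  have hsub (t : ℝ) (ht : t ∈ uIcc 0 T) : t * a ∈ uIcc 0 (T * a) := by
    have h := mem_image_of_mem (· * a) ht
    rwa [image_mul_const_uIcc, zero_mul] at h
  exact ⟨fun t => γ (t * a), by simp, rfl, fun t ht => hγΩ (hsub t ht),
    (hγ.comp_mul a).mono hsub⟩

theorem of_zero_smul {T : ℝ} {y z : E} (h : FlowsTo Ω ((0 : ℝ) • g) T y z) : z = y := by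
  obtain ⟨γ, rfl, rfl, -, hγ⟩ := h
  have := (convex_uIcc 0 T).norm_image_sub_le_of_norm_hasDerivWithin_le (C := 0) hγ
    (fun t _ => by simp) left_mem_uIcc right_mem_uIcc
  simpa [sub_eq_zero] using this

end FlowsTo

theorem flowsTo_iff_smul_one {T : ℝ} {y z : E} :
    FlowsTo Ω g T y z ↔ FlowsTo Ω (T • g) 1 y z := by
  refine ⟨fun h => .rescale T (by rwa [one_mul]), fun h => ?_⟩
  obtain rfl | hT := eq_or_ne T 0
  · obtain rfl := h.of_zero_smul
    exact .refl h.left_mem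
  · simpa [smul_smul, hT] using FlowsTo.rescale (g := T • g) (T := T) T⁻¹ (by simpa [hT] using h)

theorem FlowsTo.unique (hΩ : IsOpen Ω) (hg : ContDiffOn ℝ 1 g Ω) {T : ℝ} {y z z' : E}
    (h : FlowsTo Ω g T y z) (h' : FlowsTo Ω g T y z') : z = z' := by
  obtain ⟨γ, hγ0, rfl, hγΩ, hγ⟩ := flowsTo_iff_smul_one.1 h
  obtain ⟨γ', hγ'0, rfl, hγ'Ω, hγ'⟩ := flowsTo_iff_smul_one.1 h'
  rw [uIcc_of_le zero_le_one] at hγΩ hγ hγ'Ω hγ'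
  obtain ⟨C, hC⟩ : ∃ C, LipschitzOnWith C (T • g) (γ '' Icc 0 1 ∪ γ' '' Icc 0 1) := by
    refine LocallyLipschitzOn.exists_lipschitzOnWith_of_compact
      ((isCompact_Icc.image_of_continuousOn hγ.continuousOn).union
        (isCompact_Icc.image_of_continuousOn hγ'.continuousOn)) fun x hx => ?_
    have hxΩ : x ∈ Ω := union_subset hγΩ.image_subset hγ'Ω.image_subset hx
    obtain ⟨C, s, hs, hC⟩ :=
      ((hg.const_smul T).contDiffAt (hΩ.mem_nhds hxΩ)).exists_lipschitzOnWith
    exact ⟨C, s, mem_nhdsWithin_of_mem_nhds hs, hC⟩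
  have hIci {β : ℝ → E} (hβ : IsIntegralCurveOn β (fun _ => T • g) (Icc 0 1)) (t : ℝ)
      (ht : t ∈ Ico (0 : ℝ) 1) : HasDerivWithinAt β ((T • g) (β t)) (Ici t) t :=
    (hβ t (Ico_subset_Icc_self ht)).mono_of_mem_nhdsWithin (Icc_mem_nhdsGE_of_mem ht)
  exact ODE_solution_unique_of_mem_Icc_right (v := fun _ => T • g)
    (s := fun _ => γ '' Icc 0 1 ∪ γ' '' Icc 0 1) (fun _ _ => hC) hγ.continuousOn (hIci hγ)
    (fun t ht => .inl (mem_image_of_mem γ (Ico_subset_Icc_self ht))) hγ'.continuousOn (hIci hγ')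
    (fun t ht => .inr (mem_image_of_mem γ' (Ico_subset_Icc_self ht))) (hγ0.trans hγ'0.symm)
    (right_mem_Icc.2 zero_le_one)

theorem FlowsTo.lt_of_pos {F : E → ℝ} (hF : ∀ x ∈ Ω, DifferentiableAt ℝ F x)
    (hpos : ∀ x ∈ Ω, 0 < fderiv ℝ F x (g x)) {T : ℝ} (hT : 0 < T) {y z : E}
    (h : FlowsTo Ω g T y z) : F y < F z := by
  obtain ⟨γ, rfl, rfl, hγΩ, hγ⟩ := h
  rw [uIcc_of_le hT.le] at hγΩ hγ
  have hderiv (t : ℝ) (ht : t ∈ Icc 0 T) :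
      HasDerivWithinAt (F ∘ γ) (fderiv ℝ F (γ t) (g (γ t))) (Icc 0 T) t :=
    (hF _ (hγΩ ht)).hasFDerivAt.comp_hasDerivWithinAt t (hγ t ht)
  exact strictMonoOn_of_hasDerivWithinAt_pos (convex_Icc 0 T)
    (fun t ht => (hderiv t ht).continuousWithinAt)
    (fun t ht => (hderiv t (interior_subset ht)).mono interior_subset)
    (fun t ht => hpos _ (hγΩ (interior_subset ht))) (left_mem_Icc.2 hT.le) (right_mem_Icc.2 hT.le)
    hT

theorem FlowsTo.lt_of_lt (hΩ : IsOpen Ω) (hg : ContDiffOn ℝ 1 g Ω) {F : E → ℝ}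
    (hF : ∀ x ∈ Ω, DifferentiableAt ℝ F x) (hpos : ∀ x ∈ Ω, 0 < fderiv ℝ F x (g x))
    {S T : ℝ} (hST : S < T) {y z w : E} (hz : FlowsTo Ω g S y z) (hw : FlowsTo Ω g T y w) :
    F z < F w := by
  obtain hS | hS := le_or_gt 0 S
  · obtain ⟨z', hz', hw'⟩ := hw.exists_of_mem_uIcc (mem_uIcc_of_le hS hST.le)
    rw [hz.unique hΩ hg hz']
    exact hw'.lt_of_pos hF hpos (sub_pos.2 hST)
  obtain hT | hT := le_or_gt T 0
  · obtain ⟨w', hw', hz'⟩ := hz.exists_of_mem_uIcc (mem_uIcc_of_ge hST.le hT)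
    rw [hw.unique hΩ hg hw']
    exact hz'.symm.lt_of_pos hF hpos (by simpa using hST)
  · exact (hz.symm.lt_of_pos hF hpos (neg_pos.2 hS)).trans (hw.lt_of_pos hF hpos hT)

theorem FlowsTo.eq_of_apply_eq (hΩ : IsOpen Ω) (hg : ContDiffOn ℝ 1 g Ω) {F : E → ℝ}
    (hF : ∀ x ∈ Ω, DifferentiableAt ℝ F x) (hpos : ∀ x ∈ Ω, 0 < fderiv ℝ F x (g x))
    {S T : ℝ} {y z w : E} (hz : FlowsTo Ω g S y z) (hw : FlowsTo Ω g T y w) (hzw : F z = F w) :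
    z = w := by
  obtain hST | rfl | hTS := lt_trichotomy S T
  · exact absurd hzw (hz.lt_of_lt hΩ hg hF hpos hST hw).ne
  · exact hz.unique hΩ hg hw
  · exact absurd hzw (hw.lt_of_lt hΩ hg hF hpos hTS hz).ne'

/-- The residual of the integral equation `c t = y + T ∫₀ᵗ g (c r) dr` at `((T, y), c)`; its zeros
are the integral curves of `g` over the time span `T`, rescaled to `[0, 1]`. -/
noncomputable def flowResidual (g : E → E) (p : (ℝ × E) × C(I, E)) : C(I, E) :=
  p.2 - ContinuousMap.const I p.1.2 - p.1.1 • primitive E (superposition I g p.2)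

theorem flowResidual_eq_zero_iff {T : ℝ} {y : E} {c : C(I, E)} :
    flowResidual g ((T, y), c) = 0 ↔
      c = ContinuousMap.const I y + T • primitive E (superposition I g c) := by
  rw [flowResidual, sub_sub, sub_eq_zero]

theorem contDiffAt_flowResidual (hΩ : IsOpen Ω) {n : ℕ} (hg : ContDiffOn ℝ n g Ω)
    {p : (ℝ × E) × C(I, E)} (hp : MapsTo p.2 univ Ω) : ContDiffAt ℝ n (flowResidual g) p := by
  have hU : IsOpen {c : C(I, E) | MapsTo c univ Ω} :=
    ContinuousMap.isOpen_setOfPred_mapsTo isCompact_univ hΩ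
  have hN : ContDiffAt ℝ n (superposition I g) p.2 :=
    (contDiffOn_superposition hΩ hg).contDiffAt (hU.mem_nhds hp)
  exact (contDiffAt_snd.sub ((ContinuousLinearMap.const ℝ I).contDiff.contDiffAt.comp p
    (contDiffAt_snd.comp p contDiffAt_fst))).sub ((contDiffAt_fst.comp p contDiffAt_fst).smul
      ((primitive E).contDiff.contDiffAt.comp p (hN.comp p contDiffAt_snd)))

variable [CompleteSpace E]

theorem flowsTo_of_flowResidual_eq_zero (hg : ContinuousOn g Ω) {T : ℝ} {y : E} {c : C(I, E)}
    (hc : MapsTo c univ Ω) (h : flowResidual g ((T, y), c) = 0) : FlowsTo Ω g T y (c 1) := by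
  rw [flowResidual_eq_zero_iff] at h
  set γ : ℝ → E := fun r =>
    y + T • ∫ s in (0 : ℝ)..r, (superposition I g c).IccExtend zero_le_one s with hγ
  have hγc (t : I) : γ t = c t := (congr($h t)).symm
  rw [flowsTo_iff_smul_one]
  refine ⟨γ, by simp [hγ], hγc 1, ?_⟩
  rw [uIcc_of_le zero_le_one]
  refine ⟨fun t ht => hγc ⟨t, ht⟩ ▸ hc (mem_univ _), fun t ht => ?_⟩
  have hderiv :=
    ((hasDerivWithinAt_primitive (superposition I g c) ⟨t, ht⟩).const_smul T).const_add y
  rw [superposition_apply hg hc, ← hγc] at hderiv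
  exact hderiv

theorem FlowsTo.exists_flowResidual_eq_zero (hg : ContinuousOn g Ω) {T : ℝ} {y z : E}
    (h : FlowsTo Ω g T y z) :
    ∃ c : C(I, E), MapsTo c univ Ω ∧ c 1 = z ∧ flowResidual g ((T, y), c) = 0 := by
  obtain ⟨γ, rfl, rfl, hγΩ, hγ⟩ := flowsTo_iff_smul_one.1 h
  rw [uIcc_of_le zero_le_one] at hγΩ hγ
  set c : C(I, E) := ⟨fun t => γ t, hγ.continuousOn.comp_continuous continuous_subtype_val
    fun t => t.2⟩
  have hc : MapsTo c univ Ω := fun t _ => hγΩ t.2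
  refine ⟨c, hc, rfl, ?_⟩
  rw [flowResidual_eq_zero_iff]
  ext t
  have hsub : uIcc 0 (t : ℝ) ⊆ I := by
    rw [uIcc_of_le t.2.1]
    exact Icc_subset_Icc_right t.2.2
  have hpicard := ODE.picard_eq_of_hasDerivAt (f := fun _ => T • g) (t₀ := 0) (t := t) (u := Ω)
    ((hg.const_smul T).comp continuousOn_snd fun p hp => hp.2) (hγ.mono hsub)
    (hγΩ.mono_left hsub)
  rw [ODE.picard_apply] at hpicard
  calc c t = γ 0 + ∫ r in (0 : ℝ)..t, T • g (γ r) := hpicard.symm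
    _ = γ 0 + T • primitive E (superposition I g c) t := by
      rw [intervalIntegral.integral_smul, primitive_apply]
      congr 2
      refine intervalIntegral.integral_congr fun r hr => ?_
      rw [ContinuousMap.coe_IccExtend, IccExtend_of_mem _ _ (hsub hr), superposition_apply hg hc]
      rfl

theorem isInvertible_fderiv_flowResidual (hΩ : IsOpen Ω) (hg : ContDiffOn ℝ 1 g Ω)
    {p : (ℝ × E) × C(I, E)} (hp : MapsTo p.2 univ Ω) :
    (fderiv ℝ (flowResidual g) p ∘L .inr ℝ (ℝ × E) C(I, E)).IsInvertible := by
  obtain ⟨⟨T, y⟩, c⟩ := p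
  have hpartial : HasFDerivAt (fun d => flowResidual g ((T, y), d))
      (1 - primitive E ∘L pointwiseApply I E E (T • superposition I (fderiv ℝ g) c)) c := by
    rw [map_smul, ContinuousLinearMap.comp_smul]
    exact ((hasFDerivAt_id c).sub_const (ContinuousMap.const I y)).sub
      (((primitive E).hasFDerivAt.comp c (hasFDerivAt_superposition hΩ hg hp)).const_smul T)
  have hchain := (((contDiffAt_flowResidual (n := 1) hΩ (by simpa using hg) hp).differentiableAt
    (by simp)).hasFDerivAt.comp c (hasFDerivAt_prodMk_right (T, y) c))
  rw [hchain.unique hpartial]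
  obtain ⟨u, hu⟩ := isUnit_one_sub_volterra (T • superposition I (fderiv ℝ g) c)
  exact ⟨.unitsEquiv ℝ _ u, hu⟩

/-- The implicit function theorem in `C([0, 1], E)`, applied to the residual of the integral
equation. -/
theorem FlowsTo.exists_contDiffAt (hΩ : IsOpen Ω) {n : ℕ} (hn : n ≠ 0) (hg : ContDiffOn ℝ n g Ω)
    {T : ℝ} {y z : E} (h : FlowsTo Ω g T y z) :
    ∃ Φ : ℝ × E → E, ContDiffAt ℝ n Φ (T, y) ∧ Φ (T, y) = z ∧
      ∀ᶠ p in 𝓝 (T, y), FlowsTo Ω g p.1 p.2 (Φ p) := by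
  obtain ⟨c, hc, rfl, hres⟩ := h.exists_flowResidual_eq_zero hg.continuousOn
  have hsmooth : ContDiffAt ℝ n (flowResidual g) ((T, y), c) := contDiffAt_flowResidual hΩ hg hc
  have hn' : (n : ℕ∞ω) ≠ 0 := by simpa
  have hinv := isInvertible_fderiv_flowResidual (p := ((T, y), c)) hΩ
    (hg.of_le (by simpa [Nat.one_le_iff_ne_zero])) hc
  set ψ : ℝ × E → C(I, E) := hsmooth.implicitFunction hn' hinv
  have hψ : ContDiffAt ℝ n ψ (T, y) := hsmooth.contDiffAt_implicitFunction hn' hinv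
  have hψc : ψ (T, y) = c := hsmooth.implicitFunction_apply_self hn' hinv
  have hmem : ∀ᶠ p in 𝓝 (T, y), MapsTo (ψ p) univ Ω :=
    hψ.continuousAt.eventually_mem
      ((ContinuousMap.isOpen_setOfPred_mapsTo isCompact_univ hΩ).mem_nhds (by rwa [hψc]))
  refine ⟨fun p => ψ p 1,
    (ContinuousMap.evalCLM ℝ (1 : I) : C(I, E) →L[ℝ] E).contDiff.contDiffAt.comp (T, y) hψ,
    congr($hψc 1), ?_⟩
  filter_upwards [hsmooth.eventually_apply_implicitFunction hn' hinv, hmem] with p hp hpΩ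
  exact flowsTo_of_flowResidual_eq_zero hg.continuousOn hpΩ (hp.trans hres)

theorem FlowsTo.exists_extension (hΩ : IsOpen Ω) (hg : ContDiffOn ℝ 1 g Ω) {T : ℝ} {y z : E}
    (h : FlowsTo Ω g T y z) :
    ∃ (γ : ℝ → E) (S : ℝ), S ≠ 0 ∧ T ∈ uIcc 0 S ∧ γ 0 = y ∧ γ T = z ∧ MapsTo γ (uIcc 0 S) Ω ∧
      IsIntegralCurveOn γ (fun _ => g) (uIcc 0 S) := by
  obtain ⟨Φ, -, -, hΦ⟩ := h.exists_contDiffAt hΩ one_ne_zero (by simpa using hg)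
  have hnear : ∀ᶠ S in 𝓝 T, FlowsTo Ω g S y (Φ (S, y)) :=
    (Continuous.prodMk_left y).continuousAt.eventually hΦ
  obtain ⟨S, hS, hS0, hTS⟩ : ∃ S, FlowsTo Ω g S y (Φ (S, y)) ∧ S ≠ 0 ∧ T ∈ uIcc 0 S := by
    obtain hT | hT := le_total 0 T
    · obtain ⟨S, hS, hTS⟩ :=
        ((hnear.filter_mono nhdsWithin_le_nhds).and (self_mem_nhdsWithin (s := Ioi T))).exists
      exact ⟨S, hS, (hT.trans_lt hTS).ne', mem_uIcc_of_le hT (le_of_lt hTS)⟩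
    · obtain ⟨S, hS, hTS⟩ :=
        ((hnear.filter_mono nhdsWithin_le_nhds).and (self_mem_nhdsWithin (s := Iio T))).exists
      exact ⟨S, hS, (hTS.trans_le hT).ne, mem_uIcc_of_ge (le_of_lt hTS) hT⟩
  obtain ⟨γ, hγ0, -, hγΩ, hγ⟩ := hS
  have hγT := flowsTo_of_isIntegralCurveOn ordConnected_uIcc hγΩ hγ left_mem_uIcc hTS
  rw [hγ0, sub_zero] at hγT
  exact ⟨γ, S, hS0, hTS, hγ0, hγT.unique hΩ hg h, hγΩ, hγ⟩

theorem FlowsTo.hasDerivAt_time (hΩ : IsOpen Ω) (hg : ContDiffOn ℝ 1 g Ω) {T : ℝ} {y z : E}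
    (h : FlowsTo Ω g T y z) {φ : ℝ → E} (hφ : DifferentiableAt ℝ φ T)
    (hflow : ∀ᶠ t in 𝓝 T, FlowsTo Ω g t y (φ t)) : HasDerivAt φ (g z) T := by
  obtain ⟨γ, S, hS0, hTS, hγ0, rfl, hγΩ, hγ⟩ := h.exists_extension hΩ hg
  have heq : φ =ᶠ[𝓝[uIcc 0 S] T] γ := by
    filter_upwards [self_mem_nhdsWithin, hflow.filter_mono nhdsWithin_le_nhds] with t ht hφt
    have hγt := flowsTo_of_isIntegralCurveOn ordConnected_uIcc hγΩ hγ left_mem_uIcc ht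
    rw [hγ0, sub_zero] at hγt
    exact hφt.unique hΩ hg hγt
  have hderiv : HasDerivWithinAt φ (g (γ T)) (uIcc 0 S) T :=
    (hγ T hTS).congr_of_eventuallyEq_of_mem heq hTS
  rw [← (uniqueDiffWithinAt_uIcc hS0.symm hTS).eq_deriv _ hφ.hasDerivAt.hasDerivWithinAt hderiv]
  exact hφ.hasDerivAt

theorem FlowsTo.exists_contDiffAt_level (hΩ : IsOpen Ω) {n : ℕ} (hn : n ≠ 0)
    (hg : ContDiffOn ℝ n g Ω) {F : E → ℝ} {T : ℝ} {y z : E} (h : FlowsTo Ω g T y z)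
    (hF : ContDiffAt ℝ n F z) (hFg : fderiv ℝ F z (g z) ≠ 0) :
    ∃ H : E → E, ContDiffAt ℝ n H y ∧ H y = z ∧
      ∀ᶠ y' in 𝓝 y, F (H y') = F z ∧ ∃ T', FlowsTo Ω g T' y' (H y') := by
  obtain ⟨Φ, hΦ, rfl, hflow⟩ := h.exists_contDiffAt hΩ hn hg
  have hn' : (n : ℕ∞ω) ≠ 0 := by simpa
  have hg1 : ContDiffOn ℝ 1 g Ω := hg.of_le (by simpa [Nat.one_le_iff_ne_zero])
  set G : E × ℝ → ℝ := fun p => F (Φ (p.2, p.1))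
  have hswap : ContDiffAt ℝ n (fun p : E × ℝ => (p.2, p.1)) (y, T) := by fun_prop
  have hΦ' : ContDiffAt ℝ n (fun p : E × ℝ => Φ (p.2, p.1)) (y, T) :=
    ContDiffAt.comp (y, T) hΦ hswap
  have hGn : ContDiffAt ℝ n G (y, T) := ContDiffAt.comp (y, T) hF hΦ'
  have hpartial : HasDerivAt (fun t => G (y, t)) (fderiv ℝ F (Φ (T, y)) (g (Φ (T, y)))) T :=
    (hF.differentiableAt hn').hasFDerivAt.comp_hasDerivAt T <|
      h.hasDerivAt_time hΩ hg1
        ((hΦ.differentiableAt hn').comp T (by fun_prop : DifferentiableAt ℝ (fun t => (t, y)) T))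
        ((Continuous.prodMk_left y).continuousAt.eventually hflow)
  have hinv : (fderiv ℝ G (y, T) ∘L .inr ℝ E ℝ).IsInvertible := by
    have hchain := (hGn.differentiableAt hn').hasFDerivAt.comp T (hasFDerivAt_prodMk_right y T)
    rw [hchain.unique hpartial.hasFDerivAt]
    exact ⟨ContinuousLinearEquiv.unitsEquivAut ℝ (.mk0 _ hFg), by ext; simp⟩
  set τ : E → ℝ := hGn.implicitFunction hn' hinv
  have hτy : τ y = T := hGn.implicitFunction_apply_self hn' hinv
  have hτ : ContDiffAt ℝ n (fun y' => (τ y', y')) y :=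
    (hGn.contDiffAt_implicitFunction hn' hinv).prodMk contDiffAt_id
  refine ⟨fun y' => Φ (τ y', y'), ContDiffAt.comp y (by rwa [hτy]) hτ, congr(Φ ($hτy, y)), ?_⟩
  have hτflow : ∀ᶠ y' in 𝓝 y, FlowsTo Ω g (τ y') y' (Φ (τ y', y')) :=
    hτ.continuousAt.tendsto.eventually (by simpa only [hτy] using hflow)
  filter_upwards [hGn.eventually_apply_implicitFunction hn' hinv, hτflow] with y' hlevel hy'
  exact ⟨hlevel, _, hy'⟩

end Flow

section Gradient

variable {E : Type*} [NormedAddCommGroup E] [InnerProductSpace ℝ E] [CompleteSpace E]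
  {φ χ ψ : E → ℝ} {x : E}

theorem contDiffAt_gradient {m n : ℕ∞ω} (hφ : ContDiffAt ℝ n φ x) (hmn : m + 1 ≤ n) :
    ContDiffAt ℝ m (∇ φ) x :=
  (InnerProductSpace.toDual ℝ E).symm.contDiff.contDiffAt.comp x (hφ.fderiv_right hmn)

theorem hasFDerivAt_gradient (hφ : ContDiffAt ℝ 2 φ x) :
    HasFDerivAt (∇ φ) (fderiv ℝ (∇ φ) x) x :=
  ((contDiffAt_gradient (m := 1) hφ one_add_one_eq_two.le).differentiableAt one_ne_zero).hasFDerivAt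

theorem inner_fderiv_gradient (hφ : ContDiffAt ℝ 2 φ x) (u w : E) :
    inner ℝ (fderiv ℝ (∇ φ) x u) w = fderiv ℝ (fderiv ℝ φ) x u w := by
  have hgrad := (hasFDerivAt_gradient hφ).inner ℝ (hasFDerivAt_const w x)
  have hfderiv := ((hφ.fderiv_right (m := 1) one_add_one_eq_two.le).differentiableAt
    one_ne_zero).hasFDerivAt.clm_apply (hasFDerivAt_const w x)
  simp only [inner_gradient_left] at hgrad
  simpa using congr($(hgrad.unique hfderiv) u)

theorem inner_fderiv_gradient_comm (hφ : ContDiffAt ℝ 2 φ x) (u w : E) :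
    inner ℝ (fderiv ℝ (∇ φ) x u) w = inner ℝ (fderiv ℝ (∇ φ) x w) u := by
  rw [inner_fderiv_gradient hφ, inner_fderiv_gradient hφ]
  exact hφ.isSymmSndFDerivAt (by simp) u w

theorem fderiv_gradient_apply_gradient_of_orthogonal (hφ : ContDiffAt ℝ 2 φ x)
    (hχ : ContDiffAt ℝ 2 χ x) (horth : ∀ᶠ y in 𝓝 x, inner ℝ (∇ φ y) (∇ χ y) = 0) :
    fderiv ℝ (∇ χ) x (∇ φ x) = -fderiv ℝ (∇ φ) x (∇ χ x) := by
  have hderiv := (hasFDerivAt_gradient hφ).inner ℝ (hasFDerivAt_gradient hχ)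
  have hzero : HasFDerivAt (fun y => inner ℝ (∇ φ y) (∇ χ y)) (0 : E →L[ℝ] ℝ) x :=
    (hasFDerivAt_const (0 : ℝ) x).congr_of_eventuallyEq horth
  refine ext_inner_right ℝ fun u => ?_
  have hu : inner ℝ (∇ φ x) (fderiv ℝ (∇ χ) x u) + inner ℝ (fderiv ℝ (∇ φ) x u) (∇ χ x) = 0 := by
    simpa using congr($(hderiv.unique hzero) u)
  rw [inner_neg_left, inner_fderiv_gradient_comm hχ, inner_fderiv_gradient_comm hφ (∇ χ x),
    real_inner_comm]
  exact eq_neg_of_add_eq_zero_left hu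

theorem lieBracket_gradient_of_orthogonal (hφ : ContDiffAt ℝ 2 φ x)
    (hχ : ContDiffAt ℝ 2 χ x) (horth : ∀ᶠ y in 𝓝 x, inner ℝ (∇ φ y) (∇ χ y) = 0) :
    VectorField.lieBracket ℝ (∇ φ) (∇ χ) x = ((-2 : ℝ) • fderiv ℝ (∇ φ) x) (∇ χ x) := by
  rw [VectorField.lieBracket, fderiv_gradient_apply_gradient_of_orthogonal hφ hχ horth,
    smul_apply]
  module

theorem hasDerivWithinAt_inner_gradient_of_orthogonal {γ : ℝ → E} {J : Set ℝ} {t : ℝ}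
    (hγ : HasDerivWithinAt γ (∇ φ (γ t)) J t) (hφ : ContDiffAt ℝ 2 φ (γ t))
    (hχ : ContDiffAt ℝ 2 χ (γ t)) (hψ : ContDiffAt ℝ 2 ψ (γ t))
    (hφχ : ∀ᶠ y in 𝓝 (γ t), inner ℝ (∇ φ y) (∇ χ y) = 0)
    (hφψ : ∀ᶠ y in 𝓝 (γ t), inner ℝ (∇ φ y) (∇ ψ y) = 0) :
    HasDerivWithinAt (fun s => inner ℝ (∇ χ (γ s)) (∇ ψ (γ s)))
      (inner ℝ (VectorField.lieBracket ℝ (∇ φ) (∇ χ) (γ t)) (∇ ψ (γ t))) J t := by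
  refine (((hasFDerivAt_gradient hχ).comp_hasDerivWithinAt t hγ).inner ℝ
    ((hasFDerivAt_gradient hψ).comp_hasDerivWithinAt t hγ)).congr_deriv ?_
  rw [fderiv_gradient_apply_gradient_of_orthogonal hφ hχ hφχ,
    fderiv_gradient_apply_gradient_of_orthogonal hφ hψ hφψ,
    lieBracket_gradient_of_orthogonal hφ hχ hφχ, Function.comp_apply, Function.comp_apply,
    inner_neg_right, real_inner_comm _ (∇ χ (γ t)), inner_fderiv_gradient_comm hφ (∇ ψ (γ t)),
    smul_apply, inner_neg_left, real_inner_smul_left]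
  ring

theorem gradient_sub_gradient_mem_span {ι : Type*} [Finite ι] {F : ι → E → ℝ}
    (hF : ∀ i, ContDiffAt ℝ 1 (F i) x) (hφ : ContDiffAt ℝ 1 φ x) (hχ : ContDiffAt ℝ 1 χ x)
    (hli : LinearIndependent ℝ fun i => ∇ (F i) x)
    (heq : ∀ᶠ y in 𝓝 x, (∀ i, F i y = F i x) → φ y = χ y) :
    ∇ φ x - ∇ χ x ∈ Submodule.span ℝ (range fun i => ∇ (F i) x) := by
  have := Fintype.ofFinite ι
  have hextr : IsLocalExtrOn (fun y => φ y - χ y) {y | ∀ i, F i y = F i x} x := by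
    refine .inl ?_
    filter_upwards [self_mem_nhdsWithin, heq.filter_mono nhdsWithin_le_nhds] with y hy hyeq
    rw [hyeq hy, heq.self_of_nhds fun _ => rfl, sub_self, sub_self]
  obtain ⟨c, c₀, hne, hsum⟩ := hextr.exists_multipliers_of_hasStrictFDerivAt
    (fun i => (hF i).hasStrictFDerivAt one_ne_zero)
    ((hφ.hasStrictFDerivAt one_ne_zero).sub (hχ.hasStrictFDerivAt one_ne_zero))
  have hvec : (∑ i, c i • ∇ (F i) x) + c₀ • (∇ φ x - ∇ χ x) = 0 := by
    refine ext_inner_right ℝ fun u => ?_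
    simpa [inner_add_left, sum_inner, inner_sub_left, real_inner_smul_left,
      inner_gradient_left] using congr($hsum u)
  have hc₀ : c₀ ≠ 0 := by
    rintro rfl
    rw [zero_smul, add_zero] at hvec
    exact hne (Prod.ext (funext (Fintype.linearIndependent_iff.1 hli c hvec)) rfl)
  rw [← Submodule.smul_mem_iff _ hc₀, eq_neg_of_add_eq_zero_right hvec]
  exact Submodule.neg_mem _ (Submodule.sum_mem _ fun i _ =>
    Submodule.smul_mem _ _ (Submodule.subset_span (mem_range_self i)))

end Gradient

section Propagation

variable {E : Type*} [NormedAddCommGroup E] [InnerProductSpace ℝ E]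

theorem norm_sq_mul_inner_of_mem_span {ι : Type*} {X : ι → E} {I : Set ι} {i : ι} {F u : E}
    (hX : ∀ c ∈ I, c ≠ i → inner ℝ (X c) (X i) = 0) (hF : ∀ c ∈ I, c ≠ i → inner ℝ (X c) F = 0)
    (hu : u ∈ Submodule.span ℝ (X '' I)) :
    ‖X i‖ ^ 2 * inner ℝ u F = inner ℝ u (X i) * inner ℝ (X i) F := by
  induction hu using Submodule.span_induction with
  | mem u hu =>
    obtain ⟨c, hc, rfl⟩ := hu
    obtain rfl | hci := eq_or_ne c i
    · rw [real_inner_self_eq_norm_sq]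
    · rw [hX c hc hci, hF c hc hci, mul_zero, zero_mul]
  | zero => simp
  | add u w _ _ hu hw => rw [inner_add_left, inner_add_left, mul_add, hu, hw, add_mul]
  | smul r u _ hu => rw [real_inner_smul_left, real_inner_smul_left]; linear_combination r * hu

theorem abs_inner_apply_le_of_norm_sq_mul_inner_eq {A : E →L[ℝ] E} {X F : E}
    (h : ‖X‖ ^ 2 * inner ℝ (A X) F = inner ℝ (A X) X * inner ℝ X F) :
    |inner ℝ (A X) F| ≤ ‖A‖ * |inner ℝ X F| := by
  obtain rfl | hX := eq_or_ne X 0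
  · simp
  have hpos : 0 < ‖X‖ ^ 2 := pow_pos (norm_pos_iff.2 hX) 2
  refine le_of_mul_le_mul_left ?_ hpos
  calc ‖X‖ ^ 2 * |inner ℝ (A X) F| = |inner ℝ (A X) X| * |inner ℝ X F| := by
        rw [← abs_of_pos hpos, ← abs_mul, h, abs_mul]
    _ ≤ (‖A‖ * ‖X‖ * ‖X‖) * |inner ℝ X F| := by
        gcongr
        exact (abs_real_inner_le_norm _ _).trans (by gcongr; exact A.le_opNorm X)
    _ = ‖X‖ ^ 2 * (‖A‖ * |inner ℝ X F|) := by ring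

theorem eq_zero_of_abs_deriv_le_mul_abs_self_of_uIcc {q q' : ℝ → ℝ} {K s t : ℝ}
    (hq : ∀ r ∈ uIcc s t, HasDerivWithinAt q (q' r) (uIcc s t) r)
    (hle : ∀ r ∈ uIcc s t, |q' r| ≤ K * |q r|) (hs : q s = 0) : q t = 0 := by
  have hmaps : MapsTo (AffineMap.lineMap s t : ℝ → ℝ) (Icc 0 1) (uIcc s t) := fun r hr =>
    (convex_uIcc s t).lineMap_mem left_mem_uIcc right_mem_uIcc hr
  have hderiv (r : ℝ) (hr : r ∈ Icc (0 : ℝ) 1) :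
      HasDerivWithinAt (q ∘ AffineMap.lineMap s t)
        (q' (AffineMap.lineMap s t r) * (t - s)) (Icc 0 1) r :=
    (hq _ (hmaps hr)).comp r AffineMap.hasDerivWithinAt_lineMap hmaps
  have hzero := eq_zero_of_abs_deriv_le_mul_abs_self_of_eq_zero_right (K := |t - s| * K)
    (fun r hr => (hderiv r hr).continuousWithinAt)
    (fun r hr =>
      (hderiv r (Ico_subset_Icc_self hr)).mono_of_mem_nhdsWithin (Icc_mem_nhdsGE_of_mem hr))
    (by simpa using hs) (fun r hr => ?_) 1 (right_mem_Icc.2 zero_le_one)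
  · simpa using hzero
  · rw [norm_mul, mul_comm, mul_assoc]
    exact mul_le_mul_of_nonneg_left (hle _ (hmaps (Ico_subset_Icc_self hr))) (abs_nonneg _)

/-- The function `⟪∇ χ, ∇ ψ⟫` has derivative `⟪[∇ φ, ∇ χ], ∇ ψ⟫` along the integral curve, and the
condition `hbr` bounds this by a multiple of the function itself. -/
theorem inner_gradient_eq_zero_of_isIntegralCurveOn [CompleteSpace E] {φ χ ψ : E → ℝ} {U : Set E}
    (hU : IsOpen U) (hφ : ∀ x ∈ U, ContDiffAt ℝ 2 φ x) (hχ : ∀ x ∈ U, ContDiffAt ℝ 2 χ x)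
    (hψ : ∀ x ∈ U, ContDiffAt ℝ 2 ψ x) (hφχ : ∀ x ∈ U, inner ℝ (∇ φ x) (∇ χ x) = 0)
    (hφψ : ∀ x ∈ U, inner ℝ (∇ φ x) (∇ ψ x) = 0)
    (hbr : ∀ x ∈ U, ‖∇ χ x‖ ^ 2 * inner ℝ (VectorField.lieBracket ℝ (∇ φ) (∇ χ) x) (∇ ψ x) =
      inner ℝ (VectorField.lieBracket ℝ (∇ φ) (∇ χ) x) (∇ χ x) * inner ℝ (∇ χ x) (∇ ψ x))
    {γ : ℝ → E} {s t : ℝ} (hγU : MapsTo γ (uIcc s t) U)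
    (hγ : ∀ r ∈ uIcc s t, HasDerivWithinAt γ (∇ φ (γ r)) (uIcc s t) r)
    (hs : inner ℝ (∇ χ (γ s)) (∇ ψ (γ s)) = 0) : inner ℝ (∇ χ (γ t)) (∇ ψ (γ t)) = 0 := by
  have hnear {θ : E → ℝ} (hθ : ∀ x ∈ U, inner ℝ (∇ φ x) (∇ θ x) = 0) (r : ℝ)
      (hr : r ∈ uIcc s t) : ∀ᶠ y in 𝓝 (γ r), inner ℝ (∇ φ y) (∇ θ y) = 0 :=
    (hU.eventually_mem (hγU hr)).mono hθ
  have hHess : ContinuousOn (fun r => fderiv ℝ (∇ φ) (γ r)) (uIcc s t) := fun r hr =>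
    ((contDiffAt_gradient (m := 1) (hφ _ (hγU hr)) one_add_one_eq_two.le).continuousAt_fderiv
      one_ne_zero).comp_continuousWithinAt (hγ r hr).continuousWithinAt
  obtain ⟨K, hK⟩ := isCompact_uIcc.exists_bound_of_continuousOn (hHess.const_smul (-2 : ℝ))
  refine eq_zero_of_abs_deriv_le_mul_abs_self_of_uIcc (K := K)
    (q := fun r => inner ℝ (∇ χ (γ r)) (∇ ψ (γ r)))
    (fun r hr => hasDerivWithinAt_inner_gradient_of_orthogonal (hγ r hr) (hφ _ (hγU hr))
      (hχ _ (hγU hr)) (hψ _ (hγU hr)) (hnear hφχ r hr) (hnear hφψ r hr)) (fun r hr => ?_) hs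
  have hbr_r := hbr _ (hγU hr)
  rw [lieBracket_gradient_of_orthogonal (hφ _ (hγU hr)) (hχ _ (hγU hr)) (hnear hφχ r hr)]
    at hbr_r ⊢
  exact (abs_inner_apply_le_of_norm_sq_mul_inner_eq hbr_r).trans (by gcongr; exact hK r hr)

end Propagation

section ReferenceManifold

variable {N M : ℕ} {Ω : Set (Signal N)} {f : Fin M → Signal N → ℝ} {v : Fin M → ℝ}

theorem projGradient_eq_gramSchmidt (f : Fin M → Signal N → ℝ) (m : Fin M) (x : Signal N) :
    projGradient f m x = InnerProductSpace.gramSchmidt ℝ (fun j => ∇ (f j) x) m := by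
  have hspan := InnerProductSpace.span_gramSchmidt_Iio ℝ (fun j => ∇ (f j) x) m
  refine Submodule.eq_starProjection_of_mem_orthogonal ?_
    (Submodule.le_orthogonal_orthogonal _ ?_)
  · change _ ∈ (Submodule.span ℝ ((fun c => ∇ (f c) x) '' Iio m))ᗮ
    rw [← hspan, ← Submodule.span_singleton_le_iff_mem, ← Submodule.isOrtho_iff_le,
      Submodule.isOrtho_span]
    rintro _ rfl _ ⟨b, hb, rfl⟩
    exact InnerProductSpace.gramSchmidt_orthogonal ℝ _ (ne_of_gt hb)
  · change _ ∈ Submodule.span ℝ ((fun c => ∇ (f c) x) '' Iio m)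
    rw [InnerProductSpace.gramSchmidt_def, sub_sub_cancel, ← hspan]
    refine Submodule.sum_mem _ fun b hb => ?_
    rw [Submodule.starProjection_singleton]
    exact Submodule.smul_mem _ _ (Submodule.subset_span ⟨b, Finset.mem_Iio.1 hb, rfl⟩)

theorem span_projGradient (f : Fin M → Signal N → ℝ) (m : Fin M) (x : Signal N) :
    Submodule.span ℝ ((fun c => projGradient f c x) '' {c | c < m}) =
      Submodule.span ℝ ((fun c => ∇ (f c) x) '' {c | c < m}) := by
  simp only [projGradient_eq_gramSchmidt]
  exact InnerProductSpace.span_gramSchmidt_Iio ℝ (fun j => ∇ (f j) x) m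

theorem projGradient_mem_refTangent (f : Fin M → Signal N → ℝ) (m : Fin M) (x : Signal N) :
    projGradient f m x ∈ refTangent f m x :=
  Submodule.starProjection_apply_mem _ _

theorem inner_gradient_projGradient_of_lt {b m : Fin M} (hbm : b < m) (x : Signal N) :
    inner ℝ (∇ (f b) x) (projGradient f m x) = 0 :=
  (Submodule.mem_orthogonal _ _).1 (projGradient_mem_refTangent f m x) _
    (Submodule.subset_span ⟨b, hbm, rfl⟩)

theorem inner_gradient_projGradient_self (f : Fin M → Signal N → ℝ) (m : Fin M) (x : Signal N) :
    inner ℝ (∇ (f m) x) (projGradient f m x) = ‖projGradient f m x‖ ^ 2 := by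
  have h := Submodule.starProjection_inner_eq_zero (K := refTangent f m x) (∇ (f m) x)
    (projGradient f m x) (projGradient_mem_refTangent f m x)
  rw [inner_sub_left, sub_eq_zero] at h
  rw [h, ← real_inner_self_eq_norm_sq]
  rfl

/-- The reference manifold of the first `a` features: the points of `Ω` at which they take their
reference values. -/
def referenceManifold (Ω : Set (Signal N)) (f : Fin M → Signal N → ℝ) (v : Fin M → ℝ) (a : ℕ) :
    Set (Signal N) :=
  {x | x ∈ Ω ∧ ∀ b : Fin M, b.val < a → f b x = v b}

theorem mem_referenceManifold_zero {x : Signal N} :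
    x ∈ referenceManifold Ω f v 0 ↔ x ∈ Ω := by
  simp [referenceManifold]

theorem mem_referenceManifold_succ {a : Fin M} {x : Signal N} :
    x ∈ referenceManifold Ω f v (a + 1) ↔ x ∈ referenceManifold Ω f v a ∧ f a x = v a := by
  simp only [referenceManifold, mem_ofPred_eq, Order.lt_add_one_iff, le_iff_lt_or_eq, ← Fin.ext_iff]
  grind

theorem referenceManifold_anti : Antitone (referenceManifold Ω f v) :=
  fun _ _ hab _ hx => ⟨hx.1, fun c hc => hx.2 c (hc.trans_le hab)⟩

/-- A family of `C³` functions on an open set with linearly independent gradients. -/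
structure IsRegularFamily (Ω : Set (Signal N)) (f : Fin M → Signal N → ℝ) : Prop where
  isOpen : IsOpen Ω
  contDiffOn : ∀ j, ContDiffOn ℝ 3 (f j) Ω
  linearIndependent : ∀ x ∈ Ω, LinearIndependent ℝ (fun j => ∇ (f j) x)

namespace IsRegularFamily

theorem contDiffAt (h : IsRegularFamily Ω f) (j : Fin M) {x : Signal N} (hx : x ∈ Ω) :
    ContDiffAt ℝ 3 (f j) x :=
  (h.contDiffOn j).contDiffAt (h.isOpen.mem_nhds hx)

theorem differentiableAt (h : IsRegularFamily Ω f) (j : Fin M) {x : Signal N} (hx : x ∈ Ω) :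
    DifferentiableAt ℝ (f j) x :=
  (h.contDiffAt j hx).differentiableAt three_ne_zero

theorem projGradient_ne_zero (h : IsRegularFamily Ω f) (m : Fin M) {x : Signal N} (hx : x ∈ Ω) :
    projGradient f m x ≠ 0 := by
  rw [projGradient_eq_gramSchmidt]
  exact InnerProductSpace.gramSchmidt_ne_zero m (h.linearIndependent x hx)

theorem fderiv_projGradient_pos (h : IsRegularFamily Ω f) (m : Fin M) {x : Signal N}
    (hx : x ∈ Ω) : 0 < fderiv ℝ (f m) x (projGradient f m x) := by
  rw [← inner_gradient_left, inner_gradient_projGradient_self]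
  exact pow_pos (norm_pos_iff.2 (h.projGradient_ne_zero m hx)) 2

theorem contDiffOn_projGradient (h : IsRegularFamily Ω f) (m : Fin M) :
    ContDiffOn ℝ 2 (projGradient f m) Ω := by
  induction m using WellFoundedLT.induction with
  | ind m ih =>
    have hrec (x : Signal N) : projGradient f m x = ∇ (f m) x - ∑ b ∈ Finset.Iio m,
        (inner ℝ (projGradient f b x) (∇ (f m) x) / ‖projGradient f b x‖ ^ 2) •
          projGradient f b x := by
      simp only [projGradient_eq_gramSchmidt, InnerProductSpace.gramSchmidt_def _ _ m,
        Submodule.starProjection_singleton, RCLike.ofReal_real_eq_id, id]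
    have hm : ContDiffOn ℝ 2 (∇ (f m)) Ω := fun x hx =>
      (contDiffAt_gradient (h.contDiffAt m hx) (by norm_num)).contDiffWithinAt
    refine (hm.sub (ContDiffOn.sum fun b hb => ?_)).congr fun x _ => hrec x
    have hb := ih b (Finset.mem_Iio.1 hb)
    exact ((hb.inner ℝ hm).div (hb.norm_sq ℝ) fun x hx =>
      pow_ne_zero _ (norm_ne_zero_iff.2 (h.projGradient_ne_zero b hx))).smul hb

theorem mem_referenceManifold_of_isIntegralCurveOn (h : IsRegularFamily Ω f) {m : Fin M}
    {γ : ℝ → Signal N} {J : Set ℝ} (hJ : Convex ℝ J) (hγΩ : MapsTo γ J Ω)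
    (hγ : IsIntegralCurveOn γ (fun _ => projGradient f m) J) {s t : ℝ} (hs : s ∈ J) (ht : t ∈ J)
    (hsm : γ s ∈ referenceManifold Ω f v m) : γ t ∈ referenceManifold Ω f v m := by
  refine ⟨hγΩ ht, fun b hb => (?_ : f b (γ t) = f b (γ s)).trans (hsm.2 b hb)⟩
  have hderiv (r : ℝ) (hr : r ∈ J) : HasDerivWithinAt (f b ∘ γ) 0 J r := by
    refine ((h.differentiableAt b (hγΩ hr)).hasFDerivAt.comp_hasDerivWithinAt r
      (hγ r hr)).congr_deriv ?_
    rw [← inner_gradient_left, inner_gradient_projGradient_of_lt hb]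
  have hconst := hJ.norm_image_sub_le_of_norm_hasDerivWithin_le (C := 0) hderiv (by simp) hs ht
  rwa [zero_mul, norm_le_zero_iff, sub_eq_zero] at hconst

end IsRegularFamily

theorem followsUntil_iff {m : Fin M} {y z : Signal N} :
    FollowsUntil Ω f v m y z ↔ (∃ T, FlowsTo Ω (projGradient f m) T y z) ∧ f m z = v m := by
  constructor
  · rintro ⟨γ, T, h0, hT, hv, hγ⟩
    exact ⟨⟨T, γ, h0, hT, fun t ht => (hγ t ht).1, fun t ht => (hγ t ht).2⟩, hv⟩
  · rintro ⟨⟨T, γ, h0, hT, hγΩ, hγ⟩, hv⟩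
    exact ⟨γ, T, h0, hT, hv, fun t ht => ⟨hγΩ ht, hγ t ht⟩⟩

theorem followsUntil_self {m : Fin M} {y : Signal N}
    (hy : y ∈ referenceManifold Ω f v (m + 1)) : FollowsUntil Ω f v m y y :=
  followsUntil_iff.2 ⟨⟨0, .refl hy.1⟩, (mem_referenceManifold_succ.1 hy).2⟩

theorem narrowPath_self {m : ℕ} (hm : m ≤ M) {y : Signal N}
    (hy : y ∈ referenceManifold Ω f v m) : NarrowPath Ω f v m y y := by
  induction m with
  | zero => exact ⟨hy.1, rfl⟩
  | succ m ih =>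
    exact ⟨hm, y, ih (Nat.le_of_succ_le hm) (referenceManifold_anti m.le_succ hy),
      followsUntil_self hy⟩

theorem NarrowPath.exists_of_le {m n : ℕ} (hmn : m ≤ n) {x w : Signal N}
    (hw : NarrowPath Ω f v n x w) : ∃ y, NarrowPath Ω f v m x y := by
  induction n, hmn using Nat.le_induction generalizing w with
  | base => exact ⟨w, hw⟩
  | succ n _ ih =>
    obtain ⟨_, z, hz, -⟩ := hw
    exact ih hz

namespace IsRegularFamily

theorem followsUntil_unique (h : IsRegularFamily Ω f) {m : Fin M} {y z z' : Signal N}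
    (hz : FollowsUntil Ω f v m y z) (hz' : FollowsUntil Ω f v m y z') : z = z' := by
  obtain ⟨⟨S, hS⟩, hzv⟩ := followsUntil_iff.1 hz
  obtain ⟨⟨T, hT⟩, hzv'⟩ := followsUntil_iff.1 hz'
  exact hS.eq_of_apply_eq h.isOpen ((h.contDiffOn_projGradient m).of_le one_le_two)
    (fun _ => h.differentiableAt m) (fun _ => h.fderiv_projGradient_pos m) hT
    (hzv.trans hzv'.symm)

theorem exists_contDiffAt_followsUntil (h : IsRegularFamily Ω f) {m : Fin M} {y z : Signal N}
    (hz : FollowsUntil Ω f v m y z) : ∃ P : Signal N → Signal N, ContDiffAt ℝ 2 P y ∧ P y = z ∧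
      ∀ᶠ y' in 𝓝 y, FollowsUntil Ω f v m y' (P y') := by
  obtain ⟨⟨T, hT⟩, hzv⟩ := followsUntil_iff.1 hz
  obtain ⟨P, hP, hPy, hev⟩ := hT.exists_contDiffAt_level h.isOpen two_ne_zero
    (h.contDiffOn_projGradient m) ((h.contDiffAt m hT.right_mem).of_le (by norm_num))
    (h.fderiv_projGradient_pos m hT.right_mem).ne'
  exact ⟨P, hP, hPy, hev.mono fun y' hy' => followsUntil_iff.2 ⟨hy'.2, hy'.1.trans hzv⟩⟩

theorem narrowPath_unique (h : IsRegularFamily Ω f) {m : ℕ} {x y y' : Signal N}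
    (hy : NarrowPath Ω f v m x y) (hy' : NarrowPath Ω f v m x y') : y = y' := by
  induction m generalizing y y' with
  | zero => exact hy.2.trans hy'.2.symm
  | succ m ih =>
    obtain ⟨_, z, hz, hzy⟩ := hy
    obtain ⟨_, z', hz', hzy'⟩ := hy'
    obtain rfl := ih hz hz'
    exact h.followsUntil_unique hzy hzy'

theorem exists_contDiffAt_narrowPath (h : IsRegularFamily Ω f) {m : ℕ} {x y : Signal N}
    (hy : NarrowPath Ω f v m x y) : ∃ P : Signal N → Signal N, ContDiffAt ℝ 2 P x ∧ P x = y ∧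
      ∀ᶠ x' in 𝓝 x, NarrowPath Ω f v m x' (P x') := by
  induction m generalizing y with
  | zero =>
    exact ⟨id, contDiffAt_id, hy.2.symm,
      (h.isOpen.eventually_mem hy.1).mono fun x' hx' => ⟨hx', rfl⟩⟩
  | succ m ih =>
    obtain ⟨hm, z, hz, hzy⟩ := hy
    obtain ⟨P, hP, rfl, hPev⟩ := ih hz
    obtain ⟨Q, hQ, hQy, hQev⟩ := h.exists_contDiffAt_followsUntil hzy
    refine ⟨Q ∘ P, hQ.comp x hP, hQy, ?_⟩
    filter_upwards [hPev, hP.continuousAt.eventually hQev] with x' hPx' hQx'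
    exact ⟨hm, P x', hPx', hQx'⟩

theorem followsUntil_mem_referenceManifold (h : IsRegularFamily Ω f) {m : Fin M}
    {y z : Signal N} (hz : FollowsUntil Ω f v m y z) (hy : y ∈ referenceManifold Ω f v m) :
    z ∈ referenceManifold Ω f v (m + 1) := by
  obtain ⟨⟨T, γ, rfl, rfl, hγΩ, hγ⟩, hv⟩ := followsUntil_iff.1 hz
  exact mem_referenceManifold_succ.2 ⟨h.mem_referenceManifold_of_isIntegralCurveOn
    (convex_uIcc 0 T) hγΩ hγ left_mem_uIcc right_mem_uIcc hy, hv⟩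

theorem narrowPath_mem_referenceManifold (h : IsRegularFamily Ω f) {m : ℕ} {x y : Signal N}
    (hy : NarrowPath Ω f v m x y) : y ∈ referenceManifold Ω f v m := by
  induction m generalizing y with
  | zero => exact mem_referenceManifold_zero.2 (hy.2 ▸ hy.1)
  | succ m ih =>
    obtain ⟨hm, z, hz, hzy⟩ := hy
    exact h.followsUntil_mem_referenceManifold hzy (ih hz)

theorem narrowPath_of_meet (h : IsRegularFamily Ω f) {m n : ℕ} (hmn : m ≤ n)
    {x x' y w : Signal N} (hy : NarrowPath Ω f v m x y) (hy' : NarrowPath Ω f v m x' y)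
    (hw : NarrowPath Ω f v n x w) : NarrowPath Ω f v n x' w := by
  induction n, hmn using Nat.le_induction generalizing w with
  | base => rwa [h.narrowPath_unique hw hy]
  | succ n _ ih =>
    obtain ⟨hn, z, hz, hzw⟩ := hw
    exact ⟨hn, z, ih hz, hzw⟩

theorem isOpen_narrowDomain (h : IsRegularFamily Ω f) : IsOpen (narrowDomain Ω f v) := by
  refine isOpen_iff_mem_nhds.2 fun x hx => ?_
  have hstep (j : Fin M) : ∀ᶠ x' in 𝓝 x, ∃ y, NarrowPath Ω f v j x' y := by
    obtain ⟨y, hy⟩ := hx.2 j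
    obtain ⟨P, -, -, hev⟩ := h.exists_contDiffAt_narrowPath hy
    exact hev.mono fun x' hx' => ⟨_, hx'⟩
  exact (h.isOpen.eventually_mem hx.1).and (eventually_all.2 hstep)

theorem mem_narrowDomain_of_meet (h : IsRegularFamily Ω f) {m : ℕ} {x x' y : Signal N}
    (hx : x ∈ narrowDomain Ω f v) (hx' : x' ∈ Ω) (hy : NarrowPath Ω f v m x y)
    (hy' : NarrowPath Ω f v m x' y) : x' ∈ narrowDomain Ω f v := by
  refine ⟨hx', fun j => ?_⟩
  obtain hj | hj := le_total m j
  · exact (hx.2 j).imp fun w hw => h.narrowPath_of_meet hj hy hy' hw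
  · exact hy'.exists_of_le hj

theorem hatFeature_eq (h : IsRegularFamily Ω f) {j : Fin M} {x y : Signal N}
    (hy : NarrowPath Ω f v j x y) : hatFeature Ω f v j x = f j y := by
  have hex : ∃ y, NarrowPath Ω f v j x y := ⟨y, hy⟩
  rw [hatFeature, narrowMap, dif_pos hex, h.narrowPath_unique hex.choose_spec hy]

theorem hatFeature_eq_of_mem_referenceManifold (h : IsRegularFamily Ω f) {j : Fin M}
    {x : Signal N} (hx : x ∈ referenceManifold Ω f v j) : hatFeature Ω f v j x = f j x :=
  h.hatFeature_eq (narrowPath_self j.2.le hx)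

theorem hatFeature_eq_of_meet (h : IsRegularFamily Ω f) {m : ℕ} {x x' y : Signal N} {j : Fin M}
    (hmj : m ≤ j) (hx : x ∈ narrowDomain Ω f v) (hy : NarrowPath Ω f v m x y)
    (hy' : NarrowPath Ω f v m x' y) : hatFeature Ω f v j x' = hatFeature Ω f v j x := by
  obtain ⟨w, hw⟩ := hx.2 j
  rw [h.hatFeature_eq hw, h.hatFeature_eq (h.narrowPath_of_meet hmj hy hy' hw)]

theorem contDiffAt_hatFeature (h : IsRegularFamily Ω f) (j : Fin M) {x : Signal N}
    (hx : x ∈ narrowDomain Ω f v) : ContDiffAt ℝ 2 (hatFeature Ω f v j) x := by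
  obtain ⟨y, hy⟩ := hx.2 j
  obtain ⟨P, hP, rfl, hev⟩ := h.exists_contDiffAt_narrowPath hy
  have hfj : ContDiffAt ℝ 2 (f j) (P x) :=
    (h.contDiffAt j (h.narrowPath_mem_referenceManifold hy).1).of_le (by norm_num)
  exact (hfj.comp x hP).congr_of_eventuallyEq (hev.mono fun x' hx' => h.hatFeature_eq hx')

/-- The curve of the step adjusting `f a` is prolonged beyond its end point `γ T`, so that one can
differentiate along it even where `f a` already has its reference value. -/
theorem exists_normalizing_curve (h : IsRegularFamily Ω f) {a j : Fin M} (haj : a < j)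
    {y : Signal N} (hy : y ∈ narrowDomain Ω f v) (hya : y ∈ referenceManifold Ω f v a) :
    ∃ (γ : ℝ → Signal N) (S T : ℝ), S ≠ 0 ∧ T ∈ uIcc 0 S ∧ γ 0 = y ∧
      γ T ∈ referenceManifold Ω f v (a + 1) ∧
      MapsTo γ (uIcc 0 S) (narrowDomain Ω f v ∩ referenceManifold Ω f v a) ∧
      IsIntegralCurveOn γ (fun _ => projGradient f a) (uIcc 0 S) ∧
      ∀ t ∈ uIcc 0 S, hatFeature Ω f v j (γ t) = hatFeature Ω f v j y := by
  obtain ⟨z, hz⟩ : ∃ z, NarrowPath Ω f v (a + 1) y z :=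
    (hy.2 j).elim fun w hw => hw.exists_of_le haj
  have hyz : FollowsUntil Ω f v a y z := by
    obtain ⟨_, y', hy', hy'z⟩ := hz
    rwa [h.narrowPath_unique (narrowPath_self a.2.le hya) hy']
  obtain ⟨⟨T, hT⟩, hzv⟩ := followsUntil_iff.1 hyz
  obtain ⟨γ, S, hS, hTS, hγ0, rfl, hγΩ, hγ⟩ :=
    hT.exists_extension h.isOpen ((h.contDiffOn_projGradient a).of_le one_le_two)
  have hman (t : ℝ) (ht : t ∈ uIcc 0 S) : γ t ∈ referenceManifold Ω f v a :=
    h.mem_referenceManifold_of_isIntegralCurveOn (convex_uIcc 0 S) hγΩ hγ left_mem_uIcc ht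
      (hγ0 ▸ hya)
  have hpath (t : ℝ) (ht : t ∈ uIcc 0 S) : NarrowPath Ω f v (a + 1) (γ t) (γ T) :=
    ⟨a.2, γ t, narrowPath_self a.2.le (hman t ht), followsUntil_iff.2
      ⟨⟨_, flowsTo_of_isIntegralCurveOn ordConnected_uIcc hγΩ hγ ht hTS⟩, hzv⟩⟩
  exact ⟨γ, S, T, hS, hTS, hγ0, h.followsUntil_mem_referenceManifold hyz hya,
    fun t ht => ⟨h.mem_narrowDomain_of_meet hy (hγΩ ht) hz (hpath t ht), hman t ht⟩, hγ,
    fun t ht => h.hatFeature_eq_of_meet haj hy hz (hpath t ht)⟩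

end IsRegularFamily

end ReferenceManifold

section Decoupling

variable {N M : ℕ} {Ω : Set (Signal N)} {f : Fin M → Signal N → ℝ} {v : Fin M → ℝ}

namespace IsRegularFamily

theorem inner_gradient_hatFeature_projGradient (h : IsRegularFamily Ω f) {a j : Fin M}
    (haj : a < j) {y : Signal N} (hy : y ∈ narrowDomain Ω f v)
    (hya : y ∈ referenceManifold Ω f v a) :
    inner ℝ (∇ (hatFeature Ω f v j) y) (projGradient f a y) = 0 := by
  obtain ⟨γ, S, T, hS, -, rfl, -, -, hγ, hconst⟩ := h.exists_normalizing_curve haj hy hya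
  have hderiv : HasDerivWithinAt (hatFeature Ω f v j ∘ γ)
      (fderiv ℝ (hatFeature Ω f v j) (γ 0) (projGradient f a (γ 0))) (uIcc 0 S) 0 :=
    ((h.contDiffAt_hatFeature j hy).differentiableAt two_ne_zero).hasFDerivAt.comp_hasDerivWithinAt
      0 (hγ 0 left_mem_uIcc)
  have hzero : HasDerivWithinAt (hatFeature Ω f v j ∘ γ) 0 (uIcc 0 S) 0 :=
    (hasDerivWithinAt_const 0 (uIcc 0 S) (hatFeature Ω f v j (γ 0))).congr hconst rfl
  rw [inner_gradient_left]
  exact (uniqueDiffWithinAt_uIcc hS.symm left_mem_uIcc).eq_deriv _ hderiv hzero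

theorem gradient_hatFeature_sub_mem_span (h : IsRegularFamily Ω f) {a : Fin M} {y : Signal N}
    (hy : y ∈ narrowDomain Ω f v) (hya : y ∈ referenceManifold Ω f v a) :
    ∇ (f a) y - ∇ (hatFeature Ω f v a) y ∈
      Submodule.span ℝ ((fun c => ∇ (f c) y) '' {c | c < a}) := by
  rw [image_eq_range]
  refine gradient_sub_gradient_mem_span (F := fun b : {b : Fin M | b < a} => f b)
    (fun b => (h.contDiffAt b hya.1).of_le (by norm_num))
    ((h.contDiffAt a hya.1).of_le (by norm_num))
    ((h.contDiffAt_hatFeature a hy).of_le one_le_two)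
    ((h.linearIndependent y hya.1).comp _ Subtype.val_injective) ?_
  filter_upwards [h.isOpen.eventually_mem hya.1] with x hx hlevel
  exact (h.hatFeature_eq_of_mem_referenceManifold
    ⟨hx, fun b hb => (hlevel ⟨b, hb⟩).trans (hya.2 b hb)⟩).symm

theorem gradient_hatFeature_eq_projGradient (h : IsRegularFamily Ω f) {a : Fin M} {y : Signal N}
    (hy : y ∈ narrowDomain Ω f v) (hya : y ∈ referenceManifold Ω f v a) :
    ∇ (hatFeature Ω f v a) y = projGradient f a y := by
  refine (Submodule.eq_starProjection_of_mem_orthogonal ?_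
    (Submodule.le_orthogonal_orthogonal _ (h.gradient_hatFeature_sub_mem_span hy hya))).symm
  change _ ∈ (Submodule.span ℝ ((fun c => ∇ (f c) y) '' {c | c < a}))ᗮ
  rw [← span_projGradient, ← Submodule.span_singleton_le_iff_mem,
    ← Submodule.isOrtho_iff_le, Submodule.isOrtho_span]
  rintro _ rfl _ ⟨b, hb, rfl⟩
  exact h.inner_gradient_hatFeature_projGradient hb hy (referenceManifold_anti hb.le hya)

theorem inner_gradient_hatFeature_of_referenceManifold_succ (h : IsRegularFamily Ω f)
    {a i j : Fin M} (hai : a < i) (hij : i < j)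
    (hfrob : FrobeniusOn (hatFeature Ω f v) {c | c.val < i.val + 1} (narrowDomain Ω f v))
    (horth : ∀ b < i, ∀ l, b < l → ∀ x ∈ narrowDomain Ω f v,
      inner ℝ (∇ (hatFeature Ω f v b) x) (∇ (hatFeature Ω f v l) x) = 0)
    (hsucc : ∀ z ∈ narrowDomain Ω f v ∩ referenceManifold Ω f v (a + 1),
      inner ℝ (∇ (hatFeature Ω f v i) z) (∇ (hatFeature Ω f v j) z) = 0)
    {y : Signal N} (hy : y ∈ narrowDomain Ω f v) (hya : y ∈ referenceManifold Ω f v a) :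
    inner ℝ (∇ (hatFeature Ω f v i) y) (∇ (hatFeature Ω f v j) y) = 0 := by
  obtain ⟨γ, S, T, -, hTS, rfl, hγT, hγdom, hγ, -⟩ :=
    h.exists_normalizing_curve (hai.trans hij) hy hya
  have hsub : uIcc T 0 ⊆ uIcc 0 S := uIcc_subset_uIcc hTS left_mem_uIcc
  have hearlier {c : Fin M} (hc : c.val < i.val + 1) (hci : c ≠ i) : c < i :=
    lt_of_le_of_ne (Nat.lt_succ_iff.1 hc) hci
  refine inner_gradient_eq_zero_of_isIntegralCurveOn h.isOpen_narrowDomain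
    (fun x hx => h.contDiffAt_hatFeature a hx) (fun x hx => h.contDiffAt_hatFeature i hx)
    (fun x hx => h.contDiffAt_hatFeature j hx) (horth a hai i hai) (horth a hai j (hai.trans hij))
    (fun x hx => norm_sq_mul_inner_of_mem_span (X := fun c => ∇ (hatFeature Ω f v c) x)
      (fun c hc hci => horth c (hearlier hc hci) i (hearlier hc hci) x hx)
      (fun c hc hci => horth c (hearlier hc hci) j ((hearlier hc hci).trans hij) x hx)
      (hfrob x hx a (Nat.lt_succ_of_lt hai) i (Nat.lt_succ_self i)))
    (fun r hr => (hγdom (hsub hr)).1) (fun r hr => ?_) (hsucc _ ⟨(hγdom hTS).1, hγT⟩)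
  rw [h.gradient_hatFeature_eq_projGradient (hγdom (hsub hr)).1 (hγdom (hsub hr)).2]
  exact (hγ r (hsub hr)).mono hsub

theorem inner_gradient_hatFeature (h : IsRegularFamily Ω f) {i : Fin M}
    (hfrob : ∀ b ≤ i, 0 < b.val →
      FrobeniusOn (hatFeature Ω f v) {c | c.val < b.val + 1} (narrowDomain Ω f v)) :
    ∀ j, i < j → ∀ x ∈ narrowDomain Ω f v,
      inner ℝ (∇ (hatFeature Ω f v i) x) (∇ (hatFeature Ω f v j) x) = 0 := by
  induction i using WellFoundedLT.induction with
  | ind i ih =>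
    intro j hij x hx
    have hdown (a : ℕ) (hai : a ≤ i) : ∀ y ∈ narrowDomain Ω f v ∩ referenceManifold Ω f v a,
        inner ℝ (∇ (hatFeature Ω f v i) y) (∇ (hatFeature Ω f v j) y) = 0 := by
      induction hai using Nat.decreasingInduction with
      | self =>
        rintro y ⟨hy, hyi⟩
        rw [h.gradient_hatFeature_eq_projGradient hy hyi, real_inner_comm]
        exact h.inner_gradient_hatFeature_projGradient hij hy hyi
      | of_succ a hai hsucc =>
        rintro y ⟨hy, hya⟩
        exact h.inner_gradient_hatFeature_of_referenceManifold_succ (a := ⟨a, hai.trans i.2⟩) hai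
          hij (hfrob i le_rfl (Nat.zero_lt_of_lt hai))
          (fun b hb => ih b hb fun c hc => hfrob c (hc.trans hb.le)) hsucc hy hya
    exact hdown 0 (Nat.zero_le i) x ⟨hx, mem_referenceManifold_zero.2 hx.1⟩

end IsRegularFamily

end Decoupling

theorem mainTheorem5_general {N M : ℕ} (Ω : Set (Signal N)) (hΩ : IsOpen Ω)
    (f : Fin M → Signal N → ℝ) (hf : ∀ j, ContDiffOn ℝ 3 (f j) Ω)
    (hC1 : ∀ x ∈ Ω, LinearIndependent ℝ (fun j => ∇ (f j) x)) (v : Fin M → ℝ) {k : ℕ}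
    (hfrob : ∀ h, 1 < h → h ≤ k →
      FrobeniusOn (hatFeature Ω f v) {j | j.val < h} (narrowDomain Ω f v))
    {i j : Fin M} (hik : i.val < k) (hij : i ≠ j) :
    DecoupledOn (hatFeature Ω f v i) (hatFeature Ω f v j) (narrowDomain Ω f v) := by
  have hreg : IsRegularFamily Ω f := ⟨hΩ, hf, hC1⟩
  have hfrob_of_le (a : Fin M) (hai : a ≤ i) (b : Fin M) (hba : b ≤ a) (hb : 0 < b.val) :
      FrobeniusOn (hatFeature Ω f v) {c | c.val < b.val + 1} (narrowDomain Ω f v) :=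
    hfrob _ (Nat.lt_add_of_pos_left hb) ((Fin.le_def.1 (hba.trans hai)).trans_lt hik)
  refine fun x hx => ⟨(hreg.contDiffAt_hatFeature i hx).differentiableAt two_ne_zero,
    (hreg.contDiffAt_hatFeature j hx).differentiableAt two_ne_zero, ?_⟩
  obtain hlt | hlt := hij.lt_or_gt
  · exact hreg.inner_gradient_hatFeature (hfrob_of_le i le_rfl) j hlt x hx
  · rw [real_inner_comm]
    exact hreg.inner_gradient_hatFeature (hfrob_of_le j hlt.le) i hlt x hx

theorem mainTheorem5 {N M : ℕ} (Ω : Set (Signal N)) (hΩ : IsOpen Ω)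
    (f : Fin M → Signal N → ℝ) (hf : ∀ j, ContDiffOn ℝ 3 (f j) Ω)
    (hC1 : ∀ x ∈ Ω, LinearIndependent ℝ (fun j => gradient (f j) x))
    (v : Fin M → ℝ) :
    (∀ k : ℕ, k ≤ M →
      FrobeniusOn f {j | j.val < k} Ω →
      (∀ h : ℕ, h ≤ k →
        FrobeniusOn (hatFeature Ω f v) {j | j.val < h} (narrowDomain Ω f v)) →
      ∀ i j : Fin M, i.val < k → i ≠ j →
        DecoupledOn (hatFeature Ω f v i) (hatFeature Ω f v j) (narrowDomain Ω f v)) ∧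
    (∀ i j : Fin M, i.val = 0 → i ≠ j →
      DecoupledOn (hatFeature Ω f v i) (hatFeature Ω f v j) (narrowDomain Ω f v)) :=
  ⟨fun _ _ _ hfrob _ _ hik hij => mainTheorem5_general Ω hΩ f hf hC1 v (fun h _ => hfrob h) hik hij,
    fun _ _ hi hij => mainTheorem5_general Ω hΩ f hf hC1 v (k := 1)
      (fun _ hlt hle => absurd hle hlt.not_ge) (by omega) hij⟩
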